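/- Conventions. All spaces are $T_1$ and have no isolated points. Let $X$ be such a space and $x\in X$. For $A\subseteq X$ let $\mathrm{cl}_\theta(A)$ be the set of all $y\in X$ such that $\overline{U}\cap A\neq\emptyset$ for every neighborhood $U$ of $y$. Put $$\Omega^\theta_x=\{A\subseteq X\setminus\{x\}: x\in \mathrm{cl}_\theta(A)\},\qquad \Gamma^\theta_x=\{A\subseteq X\setminus\{x\}: A\setminus\overline{U}\text{ is finite for every neighborhood }U\text{ of }x\}$$ (so every finite subset of $X\setminus\{x\}$ belongs to $\Gamma^\theta_x$). The $\theta$-tightness $t_\theta(X,x)$ is the least infinite cardinal $\mu$ such that each $A\in\Omega^\theta_x$ has a subset $C$ with $|C|\le\mu$ and $x\in\mathrm{cl}_\theta(C)$. The $\theta$-character $\chi_\theta(X,x)$ is the least cardinality of a family $\mathcal N$ of nonempty open sets such that for each open $U$ with $x\in U$ there is $N\in\mathcal N$ with $x\in N\subseteq\overline{U}$. The cardinal $\mathfrak p$ is the least cardinality of a family $\mathcal F$ of subsets of $\omega$ such that every finite subfamily of $\mathcal F$ has infinite intersection, but there is no infinite $P\subseteq\omega$ with $P\setminus A$ finite for all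 $A\in\mathcal F$. For families $\mathcal A,\mathcal B$ of subsets of $X$, ${\sf S}_1(\mathcal A,\mathcal B)$ is the statement that for each sequence $(A_n:n<\omega)$ of elements of $\mathcal A$ there are $b_n\in A_n$ with $\{b_n:n<\omega\}\in\mathcal B$. In the game ${\sf G}_1(\mathcal A,\mathcal B)$, in inning $n<\omega$ player ONE chooses $O_n\in\mathcal A$ and TWO responds with $T_n\in O_n$; TWO wins if $\{T_n:n<\omega\}\in\mathcal B$, and otherwise ONE wins. Theorem. For every infinite cardinal $\kappa$ the following are equivalent: 1. $\kappa<\mathfrak p$. 2. For each space $X$ and point $x\in X$ with $t_\theta(X,x)=\aleph_0$ and $\chi_\theta(X,x)\le\kappa$, ONE has no winning strategy in the game ${\sf G}_1(\Omega^\theta_x,\Gamma^\theta_x)$. 3. For each space $X$ and point $x\in X$ with $t_\theta(X,x)=\aleph_0$ and $\chi_\theta(X,x)\le\kappa$, the selection principle ${\sf S}_1(\Omega^\theta_x,\Gamma^\theta_x)$ holds. -/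

import Mathlib

open Set Topology

universe u

/-- The `θ`-closure of `A`: the points all of whose neighborhoods have closure meeting `A`. -/
def thetaClosure {X : Type*} [TopologicalSpace X] (A : Set X) : Set X :=
  {x | ∀ U ∈ 𝓝 x, (closure U ∩ A).Nonempty}

/-- `A` `θ`-converges to `x`: for each neighborhood `U` of `x` the set `A \ closure U` is finite. -/
def ThetaConvergesTo {X : Type*} [TopologicalSpace X] (A : Set X) (x : X) : Prop :=
  ∀ U ∈ 𝓝 x, (A \ closure U).Finite

/-- The family `Ω^θ_x` of the sets `A ⊆ X \ {x}` with `x` in the `θ`-closure of `A`. -/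
def thetaOmega {X : Type*} [TopologicalSpace X] (x : X) : Set (Set X) :=
  {A | A ⊆ {x}ᶜ ∧ x ∈ thetaClosure A}

/-- The family `Γ^θ_x` of the sets `A ⊆ X \ {x}` that `θ`-converge to `x`. -/
def thetaGamma {X : Type*} [TopologicalSpace X] (x : X) : Set (Set X) :=
  {A | A ⊆ {x}ᶜ ∧ ThetaConvergesTo A x}

/-- The selection principle `S₁(𝒜, ℬ)`. -/
def SelectionOne {X : Type*} (𝒜 ℬ : Set (Set X)) : Prop :=
  ∀ A : ℕ → Set X, (∀ n, A n ∈ 𝒜) →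
    ∃ b : ℕ → X, (∀ n, b n ∈ A n) ∧ Set.range b ∈ ℬ

/-- ONE has a winning strategy in the game `G₁(𝒜, ℬ)` of length `ω`. A strategy `σ` assigns to the
finite sequence `[T₀, …, Tₙ₋₁]` of the previous moves of TWO the move `Oₙ ∈ 𝒜` of ONE in
inning `n`; it is winning if in no play following `σ` the set of TWO's moves belongs to `ℬ`. -/
def OneHasWinningStrategy {X : Type*} (𝒜 ℬ : Set (Set X)) : Prop :=
  ∃ σ : List X → Set X, (∀ s, σ s ∈ 𝒜) ∧
    ∀ T : ℕ → X, (∀ n, T n ∈ σ ((List.range n).map T)) → Set.range T ∉ ℬ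

/-- The `θ`-tightness `t_θ(X, x)`: the least infinite cardinal `μ` such that each `A ⊆ X \ {x}`
with `x` in the `θ`-closure of `A` has a subset `B` of cardinality at most `μ` with `x` in the
`θ`-closure of `B`. -/
noncomputable def thetaTightness (X : Type*) [TopologicalSpace X] (x : X) : Cardinal :=
  sInf {μ : Cardinal | Cardinal.aleph0 ≤ μ ∧
    ∀ A ∈ thetaOmega x, ∃ B ⊆ A, Cardinal.mk B ≤ μ ∧ x ∈ thetaClosure B}

/-- `t_θ(X, x) = ℵ₀` says that `X` is countably `θ`-tight at `x`. -/
theorem thetaTightness_eq_aleph0_iff (X : Type*) [TopologicalSpace X] (x : X) :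
    thetaTightness X x = Cardinal.aleph0 ↔
      ∀ A : Set X, A ⊆ {x}ᶜ → x ∈ thetaClosure A →
        ∃ B ⊆ A, B.Countable ∧ x ∈ thetaClosure B := by
  have hne : {μ : Cardinal | Cardinal.aleph0 ≤ μ ∧
      ∀ A ∈ thetaOmega x, ∃ B ⊆ A, Cardinal.mk B ≤ μ ∧ x ∈ thetaClosure B}.Nonempty :=
    ⟨max Cardinal.aleph0 (Cardinal.mk X), le_max_left _ _, fun A hA =>
      ⟨A, Subset.rfl, (Cardinal.mk_set_le A).trans (le_max_right _ _), hA.2⟩⟩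
  constructor
  · intro h A hA hx
    have hm := csInf_mem hne
    rw [show sInf _ = Cardinal.aleph0 from h] at hm
    obtain ⟨B, hB, hc, hxB⟩ := hm.2 A ⟨hA, hx⟩
    exact ⟨B, hB, Cardinal.le_aleph0_iff_set_countable.1 hc, hxB⟩
  · intro h
    apply le_antisymm
    · refine csInf_le' ⟨le_rfl, fun A hA => ?_⟩
      obtain ⟨B, hB, hc, hxB⟩ := h A hA.1 hA.2
      exact ⟨B, hB, Cardinal.le_aleph0_iff_set_countable.2 hc, hxB⟩
    · exact (csInf_mem hne).1

/-- `𝒩` is a `θ`-neighborhood base of `X` at `x`: a family of nonempty open sets such that for each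
open `U` containing `x` there is `N ∈ 𝒩` with `x ∈ N ⊆ closure U`. -/
def IsThetaNhdsBase {X : Type*} [TopologicalSpace X] (x : X) (𝒩 : Set (Set X)) : Prop :=
  (∀ N ∈ 𝒩, IsOpen N ∧ N.Nonempty) ∧
    ∀ U : Set X, IsOpen U → x ∈ U → ∃ N ∈ 𝒩, x ∈ N ∧ N ⊆ closure U

/-- The `θ`-character `χ_θ(X, x)`: the least cardinality of a `θ`-neighborhood base at `x`. -/
noncomputable def thetaCharacter (X : Type*) [TopologicalSpace X] (x : X) : Cardinal :=
  sInf {μ : Cardinal | ∃ 𝒩 : Set (Set X), IsThetaNhdsBase x 𝒩 ∧ Cardinal.mk 𝒩 = μ}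

/-- The pseudointersection number `𝔭`: the least cardinality of a family `F` of sets of natural
numbers such that each finite subfamily of `F` has infinite intersection, but no infinite `P` is
almost contained in every member of `F`. -/
noncomputable def pseudointersectionNumber : Cardinal.{0} :=
  sInf {μ : Cardinal.{0} | ∃ F : Set (Set ℕ),
    (∀ G ⊆ F, G.Finite → (⋂₀ G).Infinite) ∧
    (¬ ∃ P : Set ℕ, P.Infinite ∧ ∀ A ∈ F, (P \ A).Finite) ∧ Cardinal.mk F = μ}

/-! Let `κ < 𝔭`. Countable θ-tightness and a pseudointersection turn each move of ONE into a
sequence in that move which is eventually in the closure of every basic neighborhood of `x`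
(`exists_seq_eventually_mem`). If TWO picks only from these sequences, positions are coded by finite
sequences of naturals, and each of the at most `κ` basic neighborhoods demands a large enough index
at each position. Since `𝔭 ≤ 𝔟`, one function meets every demand at all but finitely many positions
(`exists_eventually_dominating`); by following it TWO defeats the strategy.

If `𝔭 ≤ κ`, a family witnessing `𝔭`, together with the final segments, generates a filter on the
columns of `ω × ℚ`. Adding a point with this filter gives a countable space where a θ-convergent
selection from the final segments of columns would yield a pseudointersection
(`not_selectionOne_filterExtension`). -/

/-! ### Pseudointersections and domination below `𝔭`. -/

open Filter in
/-- A family of fewer than `𝔭` subsets of a countably infinite type whose finite intersections are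
infinite has an infinite pseudointersection. -/
theorem exists_infinite_pseudointersection {α : Type*} [Countable α] [Infinite α] {ι : Type u}
    (hι : Cardinal.mk ι < Cardinal.lift.{u} pseudointersectionNumber) (A : ι → Set α)
    (hA : ∀ s : Finset ι, (⋂ i ∈ s, A i).Infinite) :
    ∃ P : Set α, P.Infinite ∧ ∀ i, (P \ A i).Finite := by
  classical
  obtain ⟨_⟩ := nonempty_denumerable α
  let e : α ≃ ℕ := Denumerable.eqv α
  by_contra hno
  rcases isEmpty_or_nonempty ι with h | h
  · exact hno ⟨univ, infinite_univ, isEmptyElim⟩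
  let F : Set (Set ℕ) := range fun i => e.symm ⁻¹' A i
  have hF : Cardinal.mk F < pseudointersectionNumber := by
    rw [← Cardinal.lift_lt.{0, u}]
    refine lt_of_le_of_lt ?_ hι
    simpa using Cardinal.mk_range_le_lift (f := fun i => e.symm ⁻¹' A i)
  refine notMem_of_lt_csInf' hF ⟨F, ?_, ?_, rfl⟩
  · intro G hG hGf
    have hex : ∀ g ∈ G, ∃ i, e.symm ⁻¹' A i = g := fun g hg => hG hg
    choose! j hj using hex
    have hsub : e '' (⋂ i ∈ hGf.toFinset.image j, A i) ⊆ ⋂₀ G := by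
      rintro _ ⟨y, hy, rfl⟩ g hg
      rw [← hj g hg]
      simp only [mem_iInter] at hy
      simpa using hy (j g) (Finset.mem_image_of_mem _ (hGf.mem_toFinset.2 hg))
    exact ((hA _).image e.injective.injOn).mono hsub
  · rintro ⟨P, hP, hPA⟩
    refine hno ⟨e.symm '' P, hP.image e.symm.injective.injOn, fun i => ?_⟩
    refine ((hPA _ ⟨i, rfl⟩).image e.symm).subset ?_
    rintro _ ⟨⟨n, hn, rfl⟩, h⟩
    exact ⟨n, ⟨hn, h⟩, rfl⟩

open Filter in
/-- If a countable set meets all finite intersections of a family of fewer than `𝔭` sets, then it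
contains a sequence that is eventually in each member of the family. -/
theorem exists_seq_eventually_mem {X : Type*} {ι : Type u}
    (hι : Cardinal.mk ι < Cardinal.lift.{u} pseudointersectionNumber) {A : Set X}
    (hA : A.Countable) (C : ι → Set X)
    (hC : ∀ s : Finset ι, (A ∩ ⋂ i ∈ s, C i).Nonempty) :
    ∃ a : ℕ → X, (∀ k, a k ∈ A) ∧ ∀ i, ∀ᶠ k in atTop, a k ∈ C i := by
  classical
  by_cases h : ∀ s : Finset ι, (A ∩ ⋂ i ∈ s, C i).Infinite
  · have : Countable A := hA
    have : Infinite A := ((h ∅).mono inter_subset_left).to_subtype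
    obtain ⟨P, hP, hPC⟩ := exists_infinite_pseudointersection hι
      (fun i => ((↑) : A → X) ⁻¹' C i) (fun s hs => h s <| by
        refine (hs.image ((↑) : A → X)).subset ?_
        rintro y ⟨hy, hys⟩
        exact ⟨⟨y, hy⟩, by simpa using hys, rfl⟩)
    let a := hP.natEmbedding
    refine ⟨fun k => ((a k : A) : X), fun k => (a k : A).2, fun i => ?_⟩
    rw [← Nat.cofinite_eq_atTop]
    have hinj : Function.Injective fun k => (a k : A) :=
      Subtype.val_injective.comp a.injective
    refine ((hPC i).preimage hinj.injOn).subset ?_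
    intro k hk
    exact ⟨(a k).2, hk⟩
  · push Not at h
    -- Some finite intersection with `A` is finite. If each of its points were missed by some `C j`,
    -- adding these finitely many `j` to `s` would empty it; so a constant sequence works.
    obtain ⟨s, hs⟩ := h
    by_cases hy : ∃ y ∈ A, ∀ i, y ∈ C i
    · obtain ⟨y, hyA, hyC⟩ := hy
      exact ⟨fun _ => y, fun _ => hyA, fun i => Eventually.of_forall fun _ => hyC i⟩
    · push Not at hy
      obtain ⟨y₀, hy₀, -⟩ := hC ∅
      have : Nonempty ι := ⟨(hy y₀ hy₀).choose⟩
      choose! j hj using hy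
      obtain ⟨y, hyA, hyC⟩ := hC (s ∪ hs.toFinset.image j)
      simp only [mem_iInter, Finset.mem_union] at hyC
      refine absurd (hyC (j y) (Or.inr (Finset.mem_image_of_mem _ ?_))) (hj y hyA)
      exact hs.mem_toFinset.2 ⟨hyA, by simpa using fun i hi => hyC i (Or.inl hi)⟩

open Filter in
/-- Fewer than `𝔭` functions from `ℕ` to `ℕ` are bounded modulo finite sets. -/
theorem exists_eventually_dominating_nat {κ : Cardinal.{u}} (hκ : Cardinal.aleph0 ≤ κ)
    (hp : κ < Cardinal.lift.{u} pseudointersectionNumber) {ι : Type u} (hι : Cardinal.mk ι ≤ κ)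
    (f : ι → ℕ → ℕ) : ∃ g : ℕ → ℕ, ∀ i, ∀ᶠ n in atTop, f i n ≤ g n := by
  -- Regions above monotone majorants of the `f i`, and right half-planes. A pseudointersection `P`
  -- has points arbitrarily far right, and `g k` is the height of one at or beyond `k`; monotonicity
  -- carries the bound back to `k`.
  let A : ι ⊕ ℕ → Set (ℕ × ℕ) :=
    Sum.elim (fun i => {p | partialSups (f i) p.1 ≤ p.2}) (fun k => {p | k ≤ p.1})
  have hcard : Cardinal.mk (ι ⊕ ℕ) < Cardinal.lift.{u} pseudointersectionNumber := by
    refine lt_of_le_of_lt ?_ hp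
    simpa using Cardinal.add_le_of_le hκ hι hκ
  obtain ⟨P, hP, hPA⟩ := exists_infinite_pseudointersection hcard A (fun s => by
    let K := s.sup (Sum.elim (fun _ => 0) id)
    let M : ℕ → ℕ := fun n => s.sup (Sum.elim (fun i => partialSups (f i) n) 0)
    refine (infinite_range_of_injective
      (f := fun n : ℕ => ((n + K, M (n + K)) : ℕ × ℕ)) ?_).mono ?_
    · intro m n h
      simpa using congrArg Prod.fst h
    · rintro _ ⟨n, rfl⟩
      simp only [mem_iInter]
      rintro (i | k) hi
      · exact Finset.le_sup (f := Sum.elim (fun i => partialSups (f i) (n + K)) 0) hi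
      · exact (Finset.le_sup (f := Sum.elim (fun _ => 0) id) hi).trans (Nat.le_add_left K n))
  have hq : ∀ k, ∃ q ∈ P, k ≤ q.1 := fun k => by
    by_contra! h
    exact hP ((hPA (Sum.inr k)).subset fun q hq => ⟨hq, (h q hq).not_ge⟩)
  choose q hqP hqk using hq
  refine ⟨fun k => (q k).2, fun i => ?_⟩
  obtain ⟨b, hb⟩ := ((hPA (Sum.inl i)).image Prod.fst).bddAbove
  filter_upwards [eventually_gt_atTop b] with k hk
  by_contra hlt
  refine (hk.trans_le (hqk k)).not_ge (hb ⟨q k, ⟨hqP k, fun h => hlt ?_⟩, rfl⟩)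
  exact (le_partialSups_of_le (f i) (hqk k)).trans h

open Filter in
/-- Fewer than `𝔭` functions from a countable type to `ℕ` are bounded modulo finite sets. -/
theorem exists_eventually_dominating {κ : Cardinal.{u}} (hκ : Cardinal.aleph0 ≤ κ)
    (hp : κ < Cardinal.lift.{u} pseudointersectionNumber) {ι : Type u} (hι : Cardinal.mk ι ≤ κ)
    {β : Type*} [Countable β] (f : ι → β → ℕ) :
    ∃ g : β → ℕ, ∀ i, ∀ᶠ b in cofinite, f i b ≤ g b := by
  obtain ⟨e, he⟩ := exists_injective_nat β
  obtain ⟨g, hg⟩ := exists_eventually_dominating_nat hκ hp hι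
    fun i => Function.extend e (f i) 0
  refine ⟨g ∘ e, fun i => ?_⟩
  have h := hg i
  rw [← Nat.cofinite_eq_atTop] at h
  filter_upwards [he.tendsto_cofinite.eventually h] with b hb
  rwa [he.extend_apply] at hb

/-! ### Defeating a strategy of ONE. -/

theorem exists_isThetaNhdsBase {X : Type*} [TopologicalSpace X] (x : X) :
    ∃ 𝒩 : Set (Set X), IsThetaNhdsBase x 𝒩 ∧ Cardinal.mk 𝒩 = thetaCharacter X x :=
  csInf_mem (s := {μ | ∃ 𝒩 : Set (Set X), IsThetaNhdsBase x 𝒩 ∧ Cardinal.mk 𝒩 = μ})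
    ⟨_, {U | IsOpen U ∧ U.Nonempty}, ⟨fun _ h => h, fun U hU hx =>
      ⟨U, ⟨hU, x, hx⟩, hx, subset_closure⟩⟩, rfl⟩

/-- The finite sequence of points of `X` read off from a finite sequence of indices (listed with the
latest index first) when `a s` enumerates the possible extensions of `s`. -/
def historyOfIndices {X : Type*} (a : List X → ℕ → X) : List ℕ → List X
  | [] => []
  | k :: l => historyOfIndices a l ++ [a (historyOfIndices a l) k]

/-- The sequence of indices, latest first, obtained by following `g` for `n` steps. -/
def indexBranch (g : List ℕ → ℕ) : ℕ → List ℕ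
  | 0 => []
  | n + 1 => g (indexBranch g n) :: indexBranch g n

theorem length_indexBranch (g : List ℕ → ℕ) (n : ℕ) : (indexBranch g n).length = n := by
  induction n with
  | zero => rfl
  | succ n ih => simp [indexBranch, ih]

theorem indexBranch_injective (g : List ℕ → ℕ) : Function.Injective (indexBranch g) :=
  fun m n h => by simpa [length_indexBranch] using congrArg List.length h

/-- Decoding the branch of `g` recovers exactly TWO's earlier choices, so following `g` is a legal
play. -/
theorem historyOfIndices_indexBranch {X : Type*} (a : List X → ℕ → X) (g : List ℕ → ℕ) (n : ℕ) :
    historyOfIndices a (indexBranch g n) = (List.range n).map fun m =>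
      a (historyOfIndices a (indexBranch g m)) (g (indexBranch g m)) := by
  induction n with
  | zero => rfl
  | succ n ih =>
    rw [List.range_succ, List.map_append, ← ih]
    rfl

open Filter in
theorem not_oneHasWinningStrategy_of_lt_pseudointersectionNumber {κ : Cardinal.{u}}
    (hκ : Cardinal.aleph0 ≤ κ) (hp : κ < Cardinal.lift.{u} pseudointersectionNumber)
    {X : Type u} [TopologicalSpace X] {x : X} (ht : thetaTightness X x = Cardinal.aleph0)
    (hχ : thetaCharacter X x ≤ κ) :
    ¬ OneHasWinningStrategy (thetaOmega x) (thetaGamma x) := by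
  rintro ⟨σ, hσ, hwin⟩
  obtain ⟨𝒩, h𝒩, hcard⟩ := exists_isThetaNhdsBase x
  let ι : Type u := {N : Set X // N ∈ 𝒩 ∧ x ∈ N}
  have hι : Cardinal.mk ι ≤ κ :=
    (Cardinal.mk_le_mk_of_subset (s := {N | N ∈ 𝒩 ∧ x ∈ N}) fun N h => h.1).trans
      (hcard.trans_le hχ)
  have hseq : ∀ s, ∃ a : ℕ → X, (∀ k, a k ∈ σ s) ∧
      ∀ N : ι, ∀ᶠ k in atTop, a k ∈ closure N.1 := fun s => by
    obtain ⟨B, hBσ, hB, hxB⟩ :=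
      (thetaTightness_eq_aleph0_iff X x).1 ht (σ s) (hσ s).1 (hσ s).2
    obtain ⟨a, haB, ha⟩ := exists_seq_eventually_mem (hι.trans_lt hp) hB
      (fun N : ι => closure N.1) fun t => by
        have hU : (⋂ N ∈ t, N.1) ∈ 𝓝 x := (Filter.biInter_finset_mem t).2 fun N _ =>
          (h𝒩.1 N.1 N.2.1).1.mem_nhds N.2.2
        obtain ⟨y, hyU, hyB⟩ := hxB _ hU
        exact ⟨y, hyB, mem_iInter₂.2 fun N hN => closure_mono (biInter_subset_of_mem hN) hyU⟩
    exact ⟨a, fun k => hBσ (haB k), ha⟩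
  choose a haσ ha using hseq
  simp only [eventually_atTop] at ha
  choose f hf using ha
  -- Domination needs countably many positions, hence index lists instead of lists of points of `X`.
  obtain ⟨g, hg⟩ := exists_eventually_dominating hκ hp hι
    fun (N : ι) (l : List ℕ) => f (historyOfIndices a l) N
  let T : ℕ → X := fun n => a (historyOfIndices a (indexBranch g n)) (g (indexBranch g n))
  have hT : ∀ n, T n ∈ σ ((List.range n).map T) := fun n => by
    rw [← historyOfIndices_indexBranch a g n]
    exact haσ _ _
  refine hwin T hT ⟨?_, fun U hU => ?_⟩
  · rintro _ ⟨n, rfl⟩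
    exact (hσ _).1 (hT n)
  · obtain ⟨V, hVU, hV, hxV⟩ := mem_nhds_iff.1 hU
    obtain ⟨N, hN, hxN, hNV⟩ := h𝒩.2 V hV hxV
    -- The branch never repeats a position, so it meets the finite exceptional set of `N` only
    -- finitely often.
    have hfin := (indexBranch_injective g).tendsto_cofinite.eventually (hg ⟨N, hN, hxN⟩)
    refine (Set.Finite.image T hfin).subset ?_
    rintro _ ⟨⟨n, rfl⟩, hn⟩
    refine ⟨n, fun hle => hn ?_, rfl⟩
    exact closure_minimal (hNV.trans (closure_mono hVU)) isClosed_closure (hf _ ⟨N, hN, hxN⟩ _ hle)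

/-- A sequence with no good selection is a winning strategy: ONE plays its terms in order, ignoring
TWO. -/
theorem selectionOne_of_not_oneHasWinningStrategy {X : Type*} {𝒜 ℬ : Set (Set X)}
    (h : ¬ OneHasWinningStrategy 𝒜 ℬ) : SelectionOne 𝒜 ℬ := by
  intro A hA
  by_contra! hno
  exact h ⟨fun s => A s.length, fun s => hA _, fun T hT => hno T fun n => by simpa using hT n⟩

/-! ### One-point extensions by a filter. -/

/-- The space `Y` with one more point `none`, whose punctured neighborhoods are given by the
filter `l`. -/
def FilterExtension {Y : Type*} (_ : Filter Y) : Type _ := Option Y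

namespace FilterExtension

variable {Y : Type*} {l : Filter Y}

/-- The inclusion of `Y`. -/
def incl (l : Filter Y) (y : Y) : FilterExtension l := some y

/-- The added point. -/
def point (l : Filter Y) : FilterExtension l := none

/-- The set consisting of the added point and the points of `S`. -/
def insertPoint (l : Filter Y) (S : Set Y) : Set (FilterExtension l) :=
  insert (point l) (incl l '' S)

theorem incl_injective : Function.Injective (incl l) := Option.some_injective Y

theorem incl_ne_point (y : Y) : incl l y ≠ point l := Option.some_ne_none y

theorem eq_point_or_incl (z : FilterExtension l) : z = point l ∨ ∃ y, z = incl l y := by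
  cases z with
  | none => exact Or.inl rfl
  | some y => exact Or.inr ⟨y, rfl⟩

theorem incl_preimage_insertPoint (S : Set Y) : incl l ⁻¹' insertPoint l S = S := by
  ext y
  simp [insertPoint, incl_ne_point, incl_injective.eq_iff]

variable [TopologicalSpace Y]

instance : TopologicalSpace (FilterExtension l) where
  IsOpen U := IsOpen (incl l ⁻¹' U) ∧ (point l ∈ U → incl l ⁻¹' U ∈ l)
  isOpen_univ := ⟨isOpen_univ, fun _ => Filter.univ_mem⟩
  isOpen_inter U V hU hV := ⟨hU.1.inter hV.1, fun h => Filter.inter_mem (hU.2 h.1) (hV.2 h.2)⟩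
  isOpen_sUnion S hS := by
    constructor
    · rw [preimage_sUnion]
      exact isOpen_biUnion fun U hU => (hS U hU).1
    · rintro ⟨U, hU, h⟩
      exact Filter.mem_of_superset ((hS U hU).2 h) (preimage_mono (subset_sUnion_of_mem hU))

theorem isOpen_iff {U : Set (FilterExtension l)} :
    IsOpen U ↔ IsOpen (incl l ⁻¹' U) ∧ (point l ∈ U → incl l ⁻¹' U ∈ l) := Iff.rfl

theorem isOpen_insertPoint {S : Set Y} (hS : IsOpen S) (hSl : S ∈ l) :
    IsOpen (insertPoint l S) := by
  simp only [isOpen_iff, incl_preimage_insertPoint]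
  exact ⟨hS, fun _ => hSl⟩

/-- The complement misses the added point, so the filter imposes no condition on it. Clopen members
of `l` thus give clopen neighborhoods, on which taking closures changes nothing. -/
theorem isClosed_insertPoint {S : Set Y} (hS : IsClosed S) : IsClosed (insertPoint l S) := by
  rw [← isOpen_compl_iff, isOpen_iff, preimage_compl, incl_preimage_insertPoint]
  exact ⟨hS.isOpen_compl, fun h => absurd (mem_insert _ _) h⟩

theorem t1Space [T1Space Y] (hl : ∀ y, {y}ᶜ ∈ l) : T1Space (FilterExtension l) := by
  refine ⟨fun z => ?_⟩
  rw [← isOpen_compl_iff, isOpen_iff]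
  obtain rfl | ⟨y, rfl⟩ := eq_point_or_incl z
  · have : incl l ⁻¹' {point l}ᶜ = univ := by
      ext y
      simp [incl_ne_point]
    rw [this]
    exact ⟨isOpen_univ, fun _ => Filter.univ_mem⟩
  · have : incl l ⁻¹' {incl l y}ᶜ = {y}ᶜ := by
      ext y'
      simp [incl_injective.eq_iff]
    rw [this]
    exact ⟨isOpen_compl_singleton, fun _ => hl y⟩

theorem perfectSpace [PerfectSpace Y] [l.NeBot] : PerfectSpace (FilterExtension l) := by
  rw [perfectSpace_iff_forall_not_isolated]
  intro z
  rw [Filter.neBot_iff, Ne, ← isOpen_singleton_iff_punctured_nhds, isOpen_iff]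
  rintro ⟨ho, hm⟩
  obtain rfl | ⟨y, rfl⟩ := eq_point_or_incl z
  · obtain ⟨y, hy⟩ := Filter.nonempty_of_mem (hm rfl)
    exact incl_ne_point y hy
  · rw [← image_singleton, preimage_image_eq _ incl_injective] at ho
    exact not_isOpen_singleton y ho

end FilterExtension

/-! ### The counterexample for `𝔭 ≤ κ`. -/

/-- A family witnessing the value of the pseudointersection number exists. -/
theorem exists_family_mk_eq_pseudointersectionNumber : ∃ F : Set (Set ℕ),
    (∀ G ⊆ F, G.Finite → (⋂₀ G).Infinite) ∧
    (¬ ∃ P : Set ℕ, P.Infinite ∧ ∀ A ∈ F, (P \ A).Finite) ∧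
    Cardinal.mk F = pseudointersectionNumber := by
  refine csInf_mem (s := {μ : Cardinal.{0} | ∃ F : Set (Set ℕ),
    (∀ G ⊆ F, G.Finite → (⋂₀ G).Infinite) ∧
    (¬ ∃ P : Set ℕ, P.Infinite ∧ ∀ A ∈ F, (P \ A).Finite) ∧ Cardinal.mk F = μ})
    ⟨_, {A | A ∈ Filter.hyperfilter ℕ}, fun G hG hGf hfin => ?_, ?_, rfl⟩
  · exact Filter.notMem_hyperfilter_of_finite hfin ((Filter.sInter_mem hGf).2 hG)
  · rintro ⟨P, hP, hPA⟩
    -- `Q` is every other term of an injective sequence in `P`. The ultrafilter contains `Q` or its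
    -- complement, and either one leaves out infinitely many points of `P`.
    let a := hP.natEmbedding
    have ha : Function.Injective fun n => (a n : ℕ) := Subtype.val_injective.comp a.injective
    let Q : Set ℕ := range fun n => (a (2 * n) : ℕ)
    rcases (Filter.hyperfilter ℕ).mem_or_compl_mem Q with h | h
    · refine infinite_range_of_injective (f := fun n => (a (2 * n + 1) : ℕ))
        (fun m n h => by have := ha h; omega) ((hPA Q h).subset ?_)
      rintro _ ⟨n, rfl⟩
      refine ⟨(a _).2, ?_⟩
      rintro ⟨m, hm⟩
      have := ha hm
      omega
    · refine infinite_range_of_injective (f := fun n => (a (2 * n) : ℕ))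
        (fun m n h => by have := ha h; omega) ((hPA _ h).subset ?_)
      rintro _ ⟨n, rfl⟩
      exact ⟨(a _).2, fun h => h ⟨n, rfl⟩⟩

theorem perfectSpace_prod_rat (Z : Type*) [TopologicalSpace Z] : PerfectSpace (Z × ℚ) := by
  rw [perfectSpace_iff_forall_not_isolated]
  rintro ⟨z, q⟩
  rw [Filter.neBot_iff, Ne, ← isOpen_singleton_iff_punctured_nhds]
  intro h
  have := isOpenMap_snd _ h
  rw [image_singleton] at this
  exact not_isOpen_singleton q this

/-- The filter on `ℕ` generated by `F` and the final segments. -/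
def filterOfFamily (F : Set (Set ℕ)) : Filter ℕ := Filter.generate (F ∪ range Ici)

/-- Final segments are cofinite, so they cannot exhaust an infinite finite-intersection from `F`. -/
theorem filterOfFamily_neBot {F : Set (Set ℕ)} (hF : ∀ G ⊆ F, G.Finite → (⋂₀ G).Infinite) :
    (filterOfFamily F).NeBot := by
  refine Filter.generate_neBot_iff.2 fun G hG hGf => ?_
  have hfin : (⋃ g ∈ G \ F, gᶜ).Finite := hGf.sdiff.biUnion fun g hg => by
    obtain ⟨n, rfl⟩ := (hG hg.1).resolve_left hg.2
    rw [compl_Ici]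
    exact finite_Iio n
  obtain ⟨y, hy, hyG⟩ := ((hF (G ∩ F) inter_subset_right
    (hGf.subset inter_subset_left)).sdiff hfin).nonempty
  refine ⟨y, fun g hg => ?_⟩
  by_cases hgF : g ∈ F
  · exact hy g ⟨hg, hgF⟩
  · by_contra hyg
    exact hyG (mem_biUnion ⟨hg, hgF⟩ hyg)

/-- The index of the copy of `ℚ` that contains a given point of the disjoint union of `ω` copies. -/
def column (y : ULift.{u} ℕ × ℚ) : ℕ := y.1.down

theorem continuous_column : Continuous column.{u} := continuous_uliftDown.comp continuous_fst

-- Finite intersections of generators give a base, and an infinite set has as many finite subsets as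
-- elements.
open FilterExtension in
theorem thetaCharacter_filterExtension_le {κ : Cardinal.{u}} (hκ : Cardinal.aleph0 ≤ κ)
    {F : Set (Set ℕ)} (hF : Cardinal.lift.{u} (Cardinal.mk F) ≤ κ) :
    thetaCharacter _ (point ((filterOfFamily F).comap column.{u})) ≤ κ := by
  let S : Set (Set ℕ) := F ∪ range Ici
  let N : Finset S → Set (FilterExtension ((filterOfFamily F).comap column.{u})) :=
    fun G => insertPoint _ (column ⁻¹' ⋂ A ∈ G, A.1)
  have hS : Infinite S :=
    ((infinite_range_of_injective Ici_injective).mono subset_union_right).to_subtype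
  have hcard : Cardinal.mk (range N) ≤ κ := by
    have h1 := Cardinal.mk_range_le_lift (f := N)
    rw [Cardinal.mk_finset_of_infinite] at h1
    have h2 : Cardinal.lift.{u} (Cardinal.mk S) ≤ κ := by
      refine (Cardinal.lift_le.2 (Cardinal.mk_union_le _ _)).trans ?_
      rw [Cardinal.lift_add]
      refine Cardinal.add_le_of_le hκ hF (le_trans ?_ hκ)
      simpa using Cardinal.mk_range_le (f := (Ici : ℕ → Set ℕ))
    simpa using h1.trans h2
  suffices h : IsThetaNhdsBase (point ((filterOfFamily F).comap column.{u})) (range N) from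
    le_trans (csInf_le' (s := {μ | ∃ 𝒩, IsThetaNhdsBase _ 𝒩 ∧ Cardinal.mk 𝒩 = μ})
      ⟨range N, h, rfl⟩) hcard
  constructor
  · rintro _ ⟨G, rfl⟩
    refine ⟨isOpen_insertPoint ((isOpen_discrete _).preimage continuous_column)
      (Filter.preimage_mem_comap ?_), _, mem_insert _ _⟩
    exact (Filter.biInter_finset_mem G).2 fun A _ => Filter.mem_generate_of_mem A.2
  · intro U hU hx
    obtain ⟨B, hB, hBU⟩ := (isOpen_iff.1 hU).2 hx
    obtain ⟨t, htS, ht, htB⟩ := Filter.mem_generate_iff.1 hB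
    lift t to Finset (Set ℕ) using ht
    refine ⟨_, ⟨t.attach.image fun A => ⟨A.1, htS A.2⟩, rfl⟩, mem_insert _ _, ?_⟩
    refine Subset.trans ?_ subset_closure
    refine insert_subset hx ?_
    rintro _ ⟨y, hy, rfl⟩
    refine hBU (htB ?_)
    simp only [mem_preimage, mem_iInter] at hy
    exact fun A hA => hy ⟨A, htS hA⟩ (Finset.mem_image.2 ⟨⟨A, hA⟩, Finset.mem_attach _ _, rfl⟩)

open FilterExtension in
theorem not_selectionOne_filterExtension {F : Set (Set ℕ)}
    (hF : ∀ G ⊆ F, G.Finite → (⋂₀ G).Infinite)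
    (hP : ¬ ∃ P : Set ℕ, P.Infinite ∧ ∀ A ∈ F, (P \ A).Finite) :
    ¬ SelectionOne (thetaOmega (point ((filterOfFamily F).comap column.{u})))
      (thetaGamma (point ((filterOfFamily F).comap column.{u}))) := by
  set l := (filterOfFamily F).comap column.{u} with hl
  have := filterOfFamily_neBot hF
  have hsurj : Function.Surjective column.{u} := fun n => ⟨(⟨n⟩, 0), rfl⟩
  have hne : l.NeBot := Filter.NeBot.comap_of_surj this hsurj
  intro hS
  obtain ⟨b, hb, -, hconv⟩ := hS (fun n => incl l '' (column ⁻¹' Ici n)) fun n => by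
    constructor
    · rintro _ ⟨y, -, rfl⟩
      exact incl_ne_point y
    · intro U hU
      obtain ⟨V, hVU, hV, hxV⟩ := mem_nhds_iff.1 hU
      have hn : column ⁻¹' Ici n ∈ l :=
        Filter.preimage_mem_comap (Filter.mem_generate_of_mem (Or.inr ⟨n, rfl⟩))
      obtain ⟨y, hyV, hyn⟩ := hne.nonempty_of_mem (Filter.inter_mem ((isOpen_iff.1 hV).2 hxV) hn)
      exact ⟨incl l y, subset_closure (hVU hyV), y, hyn, rfl⟩
  choose y hyn hyb using hb
  -- The columns of the selected points form the forbidden pseudointersection: the `n`-th is at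
  -- least `n`, so they are infinitely many.
  refine hP ⟨range fun n => column (y n), ?_, fun A hA => ?_⟩
  · refine infinite_of_forall_exists_gt fun n => ⟨_, ⟨n + 1, rfl⟩, ?_⟩
    exact Nat.lt_of_succ_le (hyn (n + 1))
  · have hAl : column ⁻¹' A ∈ l :=
      Filter.preimage_mem_comap (Filter.mem_generate_of_mem (Or.inl hA))
    have hfin := hconv (insertPoint l (column ⁻¹' A))
      ((isOpen_insertPoint ((isOpen_discrete A).preimage continuous_column) hAl).mem_nhds
        (mem_insert _ _))
    rw [(isClosed_insertPoint ((isClosed_discrete A).preimage continuous_column)).closure_eq] at hfin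
    refine ((hfin.preimage incl_injective.injOn).image column).subset ?_
    rintro _ ⟨⟨n, rfl⟩, hn⟩
    refine ⟨y n, ⟨⟨n, (hyb n).symm⟩, fun h => hn ?_⟩, rfl⟩
    rwa [← mem_preimage, incl_preimage_insertPoint] at h

open FilterExtension in
theorem exists_not_selectionOne {κ : Cardinal.{u}} (hκ : Cardinal.aleph0 ≤ κ)
    (hp : Cardinal.lift.{u} pseudointersectionNumber ≤ κ) :
    ∃ (X : Type u) (_ : TopologicalSpace X) (_ : T1Space X) (_ : PerfectSpace X) (x : X),
      thetaTightness X x = Cardinal.aleph0 ∧ thetaCharacter X x ≤ κ ∧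
        ¬ SelectionOne (thetaOmega x) (thetaGamma x) := by
  obtain ⟨F, hF, hP, hcard⟩ := exists_family_mk_eq_pseudointersectionNumber
  let l := (filterOfFamily F).comap column.{u}
  have := filterOfFamily_neBot hF
  have hne : l.NeBot := Filter.NeBot.comap_of_surj this fun n => ⟨(⟨n⟩, 0), rfl⟩
  have := perfectSpace_prod_rat (ULift.{u} ℕ)
  have hcount : Countable (FilterExtension l) :=
    inferInstanceAs (Countable (Option (ULift.{u} ℕ × ℚ)))
  refine ⟨FilterExtension l, inferInstance, t1Space fun y => ?_, perfectSpace, point l,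
    (thetaTightness_eq_aleph0_iff _ _).2 fun A _ hA => ⟨A, Subset.rfl, A.to_countable, hA⟩,
    thetaCharacter_filterExtension_le hκ (hcard ▸ hp), not_selectionOne_filterExtension hF hP⟩
  -- The columns strictly after that of `y` form a set in the filter that avoids `y`.
  refine ⟨Ici (column y + 1), Filter.mem_generate_of_mem (Or.inr ⟨_, rfl⟩), ?_⟩
  rintro z hz rfl
  exact Nat.not_succ_le_self _ hz

theorem mainTheorem9 (κ : Cardinal.{u}) (hκ : Cardinal.aleph0 ≤ κ) :
    List.TFAE [
      κ < Cardinal.lift.{u} pseudointersectionNumber,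
      ∀ (X : Type u) [TopologicalSpace X] [T1Space X] [PerfectSpace X] (x : X),
        thetaTightness X x = Cardinal.aleph0 → thetaCharacter X x ≤ κ →
          ¬ OneHasWinningStrategy (thetaOmega x) (thetaGamma x),
      ∀ (X : Type u) [TopologicalSpace X] [T1Space X] [PerfectSpace X] (x : X),
        thetaTightness X x = Cardinal.aleph0 → thetaCharacter X x ≤ κ →
          SelectionOne (thetaOmega x) (thetaGamma x)] := by
  
  tfae_have 1 → 2 := fun hp X _ _ _ x ht hχ =>
    not_oneHasWinningStrategy_of_lt_pseudointersectionNumber hκ hp ht hχ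
  tfae_have 2 → 3 := fun h X _ _ _ x ht hχ =>
    selectionOne_of_not_oneHasWinningStrategy (h X x ht hχ)
  tfae_have 3 → 1 := fun h => by
    by_contra hp
    obtain ⟨X, _, _, _, x, ht, hχ, hS⟩ := exists_not_selectionOne hκ (not_lt.1 hp)
    exact hS (h X x ht hχ)
  tfae_finish
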